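/- Let $\mathbb D$ be the open unit disk and $\mathbb T=\partial\mathbb D$. Let $\mu,\lambda\ge 0$ be finite positive (regular) Borel measures on $\mathbb T$. All forms and inner products are conjugate linear in the first argument. *Notation.* $H^2(\lambda)$ is the closure of the analytic polynomials in $L^2(\lambda)$. $A(\mathbb D)\subseteq C(\mathbb T)$ is the disk algebra (boundary values of functions analytic in $\mathbb D$ and continuous on $\overline{\mathbb D}$), which maps canonically onto a dense subspace of $H^2(\lambda)$. For $z\in\mathbb D$ let $k_z(\zeta)=(1-\bar z\zeta)^{-1}$. Let $\mathscr H^+(\mu)$ be the reproducing kernel Hilbert space on $\mathbb D$ of the Cauchy transforms $z\mapsto\int_{\mathbb T}\frac{h(\zeta)}{1-z\bar\zeta}\,\mu(d\zeta)$, $h\in H^2(\mu)$, with the inner product of $L^2(\mu)$ transported to it, and let $\mathrm{int}(\mu,\lambda)=\mathscr H^+(\mu)\cap\mathscr H^+(\lambda)$. Let $\mathfrak q_\mu(g,h)=\int_{\mathbb T}\overline{g}\,h\,d\mu$ with form domain $A(\mathbb D)$, regarded as a densely defined positive semi-definite form in $H^2(\lambda)$. A positive semi-definite form $\mathfrak q$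 on $A(\mathbb D)$ is *closeable* in $H^2(\lambda)$ if it has a closed extension, i.e. there is a positive semi-definite form $\mathfrak t$ on a dense subspace $\mathrm{Dom}\,\mathfrak t\subseteq H^2(\lambda)$ containing the image of $A(\mathbb D)$, such that $\mathrm{Dom}\,\mathfrak t$ is complete for the inner product $\langle\cdot,\cdot\rangle+\mathfrak t(\cdot,\cdot)$ and $\mathfrak t(a,b)=\mathfrak q(a,b)$ for all $a,b\in A(\mathbb D)$ (when $A(\mathbb D)\to H^2(\lambda)$ is not injective, this includes that $\mathfrak q$ descends to the image). Write $\mathfrak p\le\mathfrak q$ if $\mathfrak p(a,a)\le\mathfrak q(a,a)$ for all $a\in A(\mathbb D)$. A *Simon–Lebesgue decomposition* of $\mathfrak q_\mu$ in $H^2(\lambda)$ is $\mathfrak q_\mu=\mathfrak q_{ac}+\mathfrak q_s$ with $0\le\mathfrak q_{ac},\mathfrak q_s\le\mathfrak q_\mu$ such that $\mathfrak q_{ac}$ is the largest closeable positive semi-definite form $\le\mathfrak q_\mu$, and $0$ is the only closeable positive semi-definite form $\le\mathfrak q_s$. For a form $0\le\mathfrak q\le\mathfrak q_\mu$ on $A(\mathbb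 D)$, let $H^2(\mathfrak q)$ be the Hilbert space completion of $A(\mathbb D)$, modulo vectors of zero length, for the pre-inner product $\mathfrak q$, and let $\mathscr H^+(\mathfrak q)$ be the reproducing kernel Hilbert space of the functions $z\mapsto\mathfrak q(k_z,h)$ on $\mathbb D$, $h\in H^2(\mathfrak q)$, with the inner product of $H^2(\mathfrak q)$ transported to it. **Corollary.** The form $\mathfrak q_\mu$ has exactly one Simon–Lebesgue decomposition $\mathfrak q_\mu=\mathfrak q_{ac}+\mathfrak q_s$ in $H^2(\lambda)$, and for it $$\mathscr H^+(\mu)=\mathscr H^+(\mathfrak q_{ac})\oplus\mathscr H^+(\mathfrak q_s)$$ as an orthogonal direct sum: both summands are contained isometrically in $\mathscr H^+(\mu)$, they are mutually orthogonal there, and their sum is $\mathscr H^+(\mu)$. In particular, $\mathscr H^+(\mathfrak q_s)\cap\mathrm{int}(\mu,\lambda)=\{0\}$. -/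

import Mathlib

open MeasureTheory Filter Topology
open scoped ComplexConjugate ComplexOrder

noncomputable section

/-! ### Positive forms in a Hilbert space, and their Simon–Lebesgue decomposition

Forms are conjugate linear in the first and linear in the second argument. -/

/-- Sesquilinear forms on a complex vector space `V`. -/
abbrev SesqForm (V : Type*) [AddCommGroup V] [Module ℂ V] : Type _ := V →ₗ⋆[ℂ] V →ₗ[ℂ] ℂ

namespace SesqForm

variable {V : Type*} [AddCommGroup V] [Module ℂ V]

/-- `q` is positive semi-definite: `q (x, x)` is real and nonnegative for all `x`. -/
def Nonneg (q : SesqForm V) : Prop := ∀ x, 0 ≤ q x x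

/-- `p ≤ q` in the sense of forms on a common domain: `p (x, x) ≤ q (x, x)` for all `x`
(for the partial order of `ℂ`, in which comparable numbers differ by a real number). -/
def Dominated (p q : SesqForm V) : Prop := ∀ x, p x x ≤ q x x

/-- A positive semi-definite form is Hermitian. -/
theorem Nonneg.conj_symm {q : SesqForm V} (hq : q.Nonneg) (x y : V) : conj (q y x) = q x y := by
  have key : ∀ u : V, (q u u).im = 0 := fun u => ((Complex.nonneg_iff.1 (hq u)).2).symm
  have h1 := key (x + y)
  have h2 := key (x + Complex.I • y)
  have hx := key x
  have hy := key y
  simp only [map_add, LinearMap.add_apply, LinearMap.map_smulₛₗ, LinearMap.smul_apply,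
    smul_eq_mul, Complex.add_im, Complex.add_re, Complex.mul_im, Complex.mul_re, Complex.conj_I,
    Complex.I_re, Complex.I_im, RingHom.id_apply, Complex.neg_re, Complex.neg_im] at h1 h2
  apply Complex.ext
  · simp only [Complex.conj_re]; linarith
  · simp only [Complex.conj_im]; linarith

/-- The pre-inner product of a positive semi-definite form. -/
@[reducible] def Nonneg.core {q : SesqForm V} (hq : q.Nonneg) : PreInnerProductSpace.Core ℂ V where
  inner x y := q x y
  conj_inner_symm x y := hq.conj_symm x y
  re_inner_nonneg x := (Complex.nonneg_iff.1 (hq x)).1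
  add_left x y z := by simp
  smul_left x y r := by simp

/-- The vector space `V` with the pre-inner product `q`. -/
def Pre (q : SesqForm V) (_hq : q.Nonneg) : Type _ := V

variable (q : SesqForm V) (hq : q.Nonneg)

instance : SeminormedAddCommGroup (q.Pre hq) :=
  @InnerProductSpace.Core.toSeminormedAddCommGroup ℂ V _ _ _ hq.core
instance : InnerProductSpace ℂ (q.Pre hq) := InnerProductSpace.ofCore (F := V) hq.core

/-- The Hilbert space completion of `V` modulo the vectors of zero length,
with respect to the pre-inner product `q`. -/
abbrev HilbertCompletion : Type _ := UniformSpace.Completion (q.Pre hq)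

/-- The canonical map of `V` into the Hilbert space completion. -/
def toCompletion (x : V) : q.HilbertCompletion hq :=
  ((show q.Pre hq from x) : UniformSpace.Completion (q.Pre hq))

theorem inner_toCompletion (x y : V) :
    inner ℂ (q.toCompletion hq x) (q.toCompletion hq y) = q x y :=
  UniformSpace.Completion.inner_coe _ _

end SesqForm

/-- A closed positive semi-definite form in a Hilbert space `H`, with dense form domain. -/
structure ClosedForm (H : Type*) [NormedAddCommGroup H] [InnerProductSpace ℂ H] where
  /-- the form domain -/
  domain : Submodule ℂ H
  dense_domain : Dense (domain : Set H)
  /-- the form -/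
  form : SesqForm domain
  nonneg : form.Nonneg
  /-- Every Cauchy sequence for the norm of the inner product `⟪x, y⟫ + form (x, y)` on the
  domain converges in the domain for this norm. -/
  complete : ∀ u : ℕ → domain,
    Tendsto (fun p : ℕ × ℕ =>
      ‖u p.1 - u p.2‖ ^ 2 + (form (u p.1 - u p.2) (u p.1 - u p.2)).re) atTop (𝓝 0) →
    ∃ x : domain, Tendsto (fun n => ‖u n - x‖ ^ 2 + (form (u n - x) (u n - x)).re) atTop (𝓝 0)

namespace SesqForm

variable {V : Type*} [AddCommGroup V] [Module ℂ V]
variable {H : Type*} [NormedAddCommGroup H] [InnerProductSpace ℂ H]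

/-- The form `q` with domain `V`, regarded as a form in `H` through the linear map `J : V → H`
with dense range, is closeable (absolutely continuous): it has a closed extension. If `J` is the
inclusion of a dense subspace, then this is the usual notion. If `J` is not injective, then it
includes that `q` descends to a form with domain `J V`. -/
def Closeable (J : V →ₗ[ℂ] H) (q : SesqForm V) : Prop :=
  ∃ (t : ClosedForm H) (hJ : ∀ x, J x ∈ t.domain), ∀ x y, t.form ⟨J x, hJ x⟩ ⟨J y, hJ y⟩ = q x y

/-- `q = q_ac + q_s` is the Simon–Lebesgue decomposition of the positive semi-definite form `q` in
`H`: both parts are positive semi-definite forms bounded above by `q`, the form `q_ac` is the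
largest closeable form bounded above by `q`, and `q_s` is singular, that is, the only closeable
positive semi-definite form that it dominates is `0`. -/
structure IsSimonLebesgueDecomposition (J : V →ₗ[ℂ] H) (q q_ac q_s : SesqForm V) : Prop where
  add_eq : q = q_ac + q_s
  nonneg_ac : q_ac.Nonneg
  nonneg_s : q_s.Nonneg
  ac_le : q_ac.Dominated q
  s_le : q_s.Dominated q
  closeable_ac : q_ac.Closeable J
  maximal_ac : ∀ p : SesqForm V, p.Nonneg → p.Closeable J → p.Dominated q → p.Dominated q_ac
  singular_s : ∀ p : SesqForm V, p.Nonneg → p.Closeable J → p.Dominated q_s → p = 0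

end SesqForm

/-! ### The disk algebra, analytic polynomials and Szegő kernels on the circle -/

instance : MeasurableSpace Circle := borel Circle
instance : BorelSpace Circle := ⟨rfl⟩

/-- The disk algebra `A(𝔻)`, as a subspace of the continuous functions on the circle: boundary
values of the functions that are analytic in the open disk and continuous on its closure. -/
def diskAlgebra : Submodule ℂ C(Circle, ℂ) where
  carrier := {a | ∃ F : ℂ → ℂ, DiffContOnCl ℂ F (Metric.ball 0 1) ∧ ∀ ζ : Circle, F ζ = a ζ}
  zero_mem' := ⟨fun _ => 0, diffContOnCl_const, fun _ => rfl⟩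
  add_mem' := by
    rintro a b ⟨F, hF, ha⟩ ⟨G, hG, hb⟩
    exact ⟨F + G, hF.add hG, fun ζ => by simp [ha, hb]⟩
  smul_mem' := by
    rintro c a ⟨F, hF, ha⟩
    exact ⟨c • F, hF.const_smul c, fun ζ => by simp [ha]⟩

/-- The monomial `ζ ^ n` on the circle. -/
def circleMonomial (n : ℕ) : C(Circle, ℂ) := ⟨fun ζ => (ζ : ℂ) ^ n, by fun_prop⟩

/-- The analytic polynomials, as functions on the circle. -/
def analyticPolynomials : Submodule ℂ C(Circle, ℂ) := Submodule.span ℂ (Set.range circleMonomial)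

theorem one_sub_mul_circle_ne_zero {w : ℂ} (hw : ‖w‖ < 1) (ζ : Circle) : 1 - w * (ζ : ℂ) ≠ 0 := by
  intro h
  have h1 : w * (ζ : ℂ) = 1 := (sub_eq_zero.1 h).symm
  have h2 : ‖w‖ = 1 := by simpa [Circle.norm_coe] using congrArg norm h1
  linarith

/-- The Szegő kernel vector `k_z (ζ) = (1 - conj z * ζ)⁻¹`, for `z` in the open disk. -/
def szegoKernel (z : Complex.UnitDisc) : C(Circle, ℂ) where
  toFun ζ := (1 - conj (z : ℂ) * (ζ : ℂ))⁻¹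
  continuous_toFun := by
    refine Continuous.inv₀ (by fun_prop) fun ζ => one_sub_mul_circle_ne_zero ?_ ζ
    simpa using z.norm_lt_one

theorem szegoKernel_mem (z : Complex.UnitDisc) : szegoKernel z ∈ diskAlgebra := by
  refine ⟨fun w => (1 - conj (z : ℂ) * w)⁻¹, ?_, fun ζ => rfl⟩
  have hne : ∀ w ∈ closure (Metric.ball (0 : ℂ) 1), 1 - conj (z : ℂ) * w ≠ 0 := by
    intro w hw h
    rw [closure_ball _ one_ne_zero, mem_closedBall_zero_iff] at hw
    have h1 : conj (z : ℂ) * w = 1 := (sub_eq_zero.1 h).symm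
    have h2 : ‖(z : ℂ)‖ * ‖w‖ = 1 := by simpa using congrArg norm h1
    nlinarith [z.norm_lt_one, norm_nonneg (z : ℂ), norm_nonneg w]
  refine DiffContOnCl.inv ?_ hne
  exact Differentiable.diffContOnCl (by fun_prop)

/-- The analytic polynomials are dense in the disk algebra for the supremum norm. -/
theorem diskAlgebra_le_closure_polynomials :
    diskAlgebra ≤ analyticPolynomials.topologicalClosure := by
  rintro a ⟨F, hF, hFa⟩
  change a ∈ closure (analyticPolynomials : Set C(Circle, ℂ))
  rw [Metric.mem_closure_iff]
  intro ε hε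
  have hcont : ContinuousOn F (Metric.closedBall 0 1) := hF.continuousOn_ball
  have huc : UniformContinuousOn F (Metric.closedBall 0 1) :=
    (isCompact_closedBall (0 : ℂ) 1).uniformContinuousOn_of_continuous hcont
  obtain ⟨δ, hδ, hδF⟩ := Metric.uniformContinuousOn_iff.1 huc (ε / 4) (by linarith)
  obtain ⟨r, hr0, hr1, hrδ⟩ : ∃ r : ℝ, 0 < r ∧ r < 1 ∧ 1 - r < δ := by
    refine ⟨max (1 / 2) (1 - δ / 2), lt_max_of_lt_left (by norm_num),
      max_lt (by norm_num) (by linarith), ?_⟩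
    have := le_max_right (1 / 2) (1 - δ / 2)
    linarith
  obtain ⟨s, hrs, hs1⟩ := exists_between hr1
  have hps := DiffContOnCl.hasFPowerSeriesOnBall (R := 1) (c := (0 : ℂ)) (f := F)
    (by simpa using hF) one_pos
  set P := cauchyPowerSeries F 0 (1 : NNReal) with hP
  have hs0 : 0 ≤ s := (hr0.trans hrs).le
  lift s to NNReal using hs0
  have hunif := hps.tendstoUniformlyOn (r' := s) (by
    rw [ENNReal.coe_lt_coe, ← NNReal.coe_lt_coe]; exact hs1)
  obtain ⟨n, hn⟩ := (Metric.tendstoUniformlyOn_iff.1 hunif (ε / 4) (by linarith)).exists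
  refine ⟨∑ k ∈ Finset.range n, (P.coeff k * (r : ℂ) ^ k) • circleMonomial k, ?_, ?_⟩
  · exact Submodule.sum_mem _ fun k _ => Submodule.smul_mem _ _ (Submodule.subset_span ⟨k, rfl⟩)
  · refine lt_of_le_of_lt ((ContinuousMap.dist_le (by positivity : 0 ≤ ε / 2)).2 fun ζ => ?_)
      (by linarith)
    have hζ : ‖(ζ : ℂ)‖ = 1 := Circle.norm_coe ζ
    have hrζ : ‖(r : ℂ) * ζ‖ = r := by simp [Circle.norm_coe, abs_of_pos hr0]
    have h1 : dist (F ζ) (F (r * ζ)) < ε / 4 := by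
      refine hδF _ (by simp [hζ]) _ (by rw [mem_closedBall_zero_iff, hrζ]; exact hr1.le) ?_
      have : (ζ : ℂ) - r * ζ = ((1 - r : ℝ) : ℂ) * ζ := by push_cast; ring
      rw [dist_eq_norm, this, norm_mul, hζ, mul_one, Complex.norm_real, Real.norm_eq_abs,
        abs_of_pos (by linarith)]
      exact hrδ
    have h2 := hn ((r : ℂ) * ζ) (by rw [mem_ball_zero_iff, hrζ]; exact hrs)
    have h3 : P.partialSum n ((r : ℂ) * ζ) =
        (∑ k ∈ Finset.range n, (P.coeff k * (r : ℂ) ^ k) • circleMonomial k) ζ := by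
      rw [FormalMultilinearSeries.partialSum, ContinuousMap.sum_apply]
      refine Finset.sum_congr rfl fun k _ => ?_
      rw [FormalMultilinearSeries.apply_eq_pow_smul_coeff]
      simp only [circleMonomial, ContinuousMap.smul_apply, ContinuousMap.coe_mk, smul_eq_mul]
      ring
    rw [h3, zero_add] at h2
    rw [← hFa]
    linarith [dist_triangle (F ζ) (F (r * ζ))
      ((∑ k ∈ Finset.range n, (P.coeff k * (r : ℂ) ^ k) • circleMonomial k) ζ)]

/-- The span of the Szegő kernels is dense in the disk algebra for the supremum norm. -/
theorem diskAlgebra_le_closure_szegoKernel :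
    diskAlgebra ≤ (Submodule.span ℂ (Set.range szegoKernel)).topologicalClosure := by
  set S := (Submodule.span ℂ (Set.range szegoKernel)).topologicalClosure with hS
  have hSc : IsClosed (S : Set C(Circle, ℂ)) := Submodule.isClosed_topologicalClosure _
  -- the functions `ζ ^ n / (1 - w * ζ)`
  let g : ℕ → Complex.UnitDisc → C(Circle, ℂ) := fun n w => circleMonomial n * szegoKernel (star w)
  have hg : ∀ n w (ζ : Circle), g n w ζ = (ζ : ℂ) ^ n * (1 - (w : ℂ) * ζ)⁻¹ := by
    intro n w ζ
    simp [g, circleMonomial, szegoKernel]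
  have hg0 : ∀ n, g n 0 = circleMonomial n := by
    intro n; ext ζ; rw [hg]; simp [circleMonomial]
  have hgc : ∀ n, Continuous (g n) := by
    intro n
    refine ContinuousMap.continuous_of_continuous_uncurry _ ?_
    have : (Function.uncurry fun w ζ => g n w ζ) =
        fun p : Complex.UnitDisc × Circle => (p.2 : ℂ) ^ n * (1 - (p.1 : ℂ) * p.2)⁻¹ := by
      ext ⟨w, ζ⟩; exact hg n w ζ
    rw [this]
    have hc := Complex.UnitDisc.continuous_coe
    refine Continuous.mul (by fun_prop) (Continuous.inv₀ (by fun_prop) fun p => ?_)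
    exact one_sub_mul_circle_ne_zero p.1.norm_lt_one p.2
  have hmem : ∀ n w, g n w ∈ S := by
    intro n
    induction n with
    | zero =>
      intro w
      have : g 0 w = szegoKernel (star w) := by ext ζ; simp [g, circleMonomial]
      rw [this]
      exact Submodule.le_topologicalClosure _ (Submodule.subset_span ⟨_, rfl⟩)
    | succ n ih =>
      have hne : ∀ w : Complex.UnitDisc, w ≠ 0 → g (n + 1) w ∈ S := by
        intro w hw
        have hw' : (w : ℂ) ≠ 0 := by simpa using hw
        have : g (n + 1) w = ((w : ℂ)⁻¹) • (g n w - g n 0) := by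
          ext ζ
          have h1 := one_sub_mul_circle_ne_zero w.norm_lt_one ζ
          rw [hg0, ContinuousMap.smul_apply, ContinuousMap.sub_apply, hg, hg, smul_eq_mul]
          simp only [circleMonomial, ContinuousMap.coe_mk]
          field_simp
          ring
        rw [this]
        exact S.smul_mem _ (S.sub_mem (ih w) (ih 0))
      intro w
      by_cases hw : w = 0
      · subst hw
        let v : ℕ → Complex.UnitDisc := fun k =>
          Complex.UnitDisc.mk ((1 / ((k : ℝ) + 2) : ℝ) : ℂ) (by
            rw [Complex.norm_real, Real.norm_of_nonneg (by positivity), div_lt_one (by positivity)]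
            linarith [(Nat.cast_nonneg k : (0 : ℝ) ≤ k)])
        have hv : Tendsto v atTop (𝓝 0) := by
          rw [Complex.UnitDisc.isEmbedding_coe.tendsto_nhds_iff]
          have h0 : Tendsto (fun k : ℕ => (1 / ((k : ℝ) + 2) : ℝ)) atTop (𝓝 0) := by
            have := (tendsto_one_div_add_atTop_nhds_zero_nat (𝕜 := ℝ)).comp (tendsto_add_atTop_nat 1)
            refine this.congr fun k => ?_
            simp only [Function.comp]; push_cast; ring
          have := (Complex.continuous_ofReal.tendsto (0 : ℝ)).comp h0
          simpa [Function.comp_def, v] using this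
        refine hSc.mem_of_tendsto (((hgc (n + 1)).tendsto 0).comp hv) (.of_forall fun k => ?_)
        refine hne _ fun h => ?_
        have := congrArg Complex.UnitDisc.coe h
        have h2 : ((k : ℝ) + 2 : ℝ) ≠ 0 := by positivity
        have h3 : (((1 / ((k : ℝ) + 2) : ℝ) : ℂ)) = 0 := by simpa [v] using this
        rw [Complex.ofReal_eq_zero] at h3
        exact one_div_ne_zero h2 h3
      · exact hne w hw
  refine diskAlgebra_le_closure_polynomials.trans
    (Submodule.topologicalClosure_minimal _ (Submodule.span_le.2 ?_) hSc)
  rintro _ ⟨n, rfl⟩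
  rw [← hg0]
  exact hmem n 0

/-! ### `H²(μ)` and the form of a measure -/

section Measure

variable (μ : Measure Circle) [IsFiniteMeasure μ]

/-- `H²(μ)`, the closure of the analytic polynomials in `L²(μ)`. -/
def hardySpace : Submodule ℂ (Lp ℂ 2 μ) :=
  (analyticPolynomials.map (ContinuousMap.toLp 2 μ ℂ : C(Circle, ℂ) →L[ℂ] Lp ℂ 2 μ).toLinearMap).topologicalClosure

instance : CompleteSpace (hardySpace μ) :=
  (Submodule.isClosed_topologicalClosure _).completeSpace_coe

theorem toLp_mem_hardySpace {a : C(Circle, ℂ)} (ha : a ∈ diskAlgebra) :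
    ContinuousMap.toLp 2 μ ℂ a ∈ hardySpace μ := by
  have h := diskAlgebra_le_closure_polynomials ha
  exact map_mem_closure (ContinuousMap.toLp 2 μ ℂ : C(Circle, ℂ) →L[ℂ] Lp ℂ 2 μ).continuous h
    fun p hp => Submodule.mem_map_of_mem hp

/-- The canonical map of the disk algebra onto a dense subspace of `H²(μ)`. -/
def diskAlgebraToHardy : diskAlgebra →ₗ[ℂ] hardySpace μ where
  toFun a := ⟨ContinuousMap.toLp 2 μ ℂ (a : C(Circle, ℂ)), toLp_mem_hardySpace μ a.2⟩
  map_add' a b := by ext1; simp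
  map_smul' c a := by ext1; simp

/-- The form `q_μ (g, h) = ∫ conj g * h dμ` on the disk algebra. -/
def measureForm : SesqForm diskAlgebra :=
  have hi : ∀ f g : C(Circle, ℂ), Integrable (fun ζ => conj (f ζ) * g ζ) μ := fun f g =>
    Continuous.integrable_of_hasCompactSupport (by fun_prop) (HasCompactSupport.of_compactSpace _)
  LinearMap.mk₂'ₛₗ (starRingEnd ℂ) (RingHom.id ℂ)
    (fun g h => ∫ ζ, conj ((g : C(Circle, ℂ)) ζ) * (h : C(Circle, ℂ)) ζ ∂μ)
    (fun g₁ g₂ h => by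
      rw [← integral_add (hi _ _) (hi _ _)]
      exact integral_congr_ae (.of_forall fun ζ => by simp [add_mul]))
    (fun c g h => by
      rw [smul_eq_mul, ← integral_const_mul]
      exact integral_congr_ae (.of_forall fun ζ => by simp [mul_assoc]))
    (fun g h₁ h₂ => by
      rw [← integral_add (hi _ _) (hi _ _)]
      exact integral_congr_ae (.of_forall fun ζ => by simp [mul_add]))
    (fun c g h => by
      rw [smul_eq_mul, ← integral_const_mul]
      exact integral_congr_ae (.of_forall fun ζ => by simp [mul_left_comm]))

theorem measureForm_apply (g h : diskAlgebra) :
    measureForm μ g h = ∫ ζ, conj ((g : C(Circle, ℂ)) ζ) * (h : C(Circle, ℂ)) ζ ∂μ := rfl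

end Measure

/-! ### Spaces of Cauchy transforms -/

/-- A vector that is orthogonal to (the images of) all Szegő kernels is zero. -/
theorem eq_zero_of_inner_szegoKernel {H : Type*} [NormedAddCommGroup H] [InnerProductSpace ℂ H]
    (J : diskAlgebra →L[ℂ] H) (hJ : DenseRange J) (f : H)
    (hf : ∀ z, inner ℂ (J ⟨szegoKernel z, szegoKernel_mem z⟩) f = 0) : f = 0 := by
  have h1 : ∀ a : diskAlgebra, inner ℂ (J a) f = 0 := by
    have hcl : closure ((Submodule.span ℂ
        (Set.range fun z => (⟨szegoKernel z, szegoKernel_mem z⟩ : diskAlgebra)) :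
        Submodule ℂ diskAlgebra) : Set diskAlgebra) = Set.univ := by
      refine Set.eq_univ_of_forall fun a => ?_
      have ha := diskAlgebra_le_closure_szegoKernel a.2
      rw [closure_subtype]
      have : Subtype.val '' ((Submodule.span ℂ
          (Set.range fun z => (⟨szegoKernel z, szegoKernel_mem z⟩ : diskAlgebra)) :
          Submodule ℂ diskAlgebra) : Set diskAlgebra) =
          (Submodule.span ℂ (Set.range szegoKernel) : Set C(Circle, ℂ)) := by
        have h := Submodule.map_span diskAlgebra.subtype
          (Set.range fun z => (⟨szegoKernel z, szegoKernel_mem z⟩ : diskAlgebra))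
        have h' := congrArg (fun S : Submodule ℂ C(Circle, ℂ) => (S : Set C(Circle, ℂ))) h
        rw [← Set.range_comp] at h'
        exact h'
      rw [this]
      exact ha
    intro a
    have hc : IsClosed {a : diskAlgebra | inner ℂ (J a) f = 0} :=
      isClosed_eq (by fun_prop) continuous_const
    have hle : ((Submodule.span ℂ
        (Set.range fun z => (⟨szegoKernel z, szegoKernel_mem z⟩ : diskAlgebra)) :
        Submodule ℂ diskAlgebra) : Set diskAlgebra) ⊆ {a : diskAlgebra | inner ℂ (J a) f = 0} := by
      intro b hb
      induction hb using Submodule.span_induction with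
      | mem x hx => obtain ⟨z, rfl⟩ := hx; exact hf z
      | zero => simp
      | add x y _ _ hx hy =>
        simp only [Set.mem_ofPred_eq] at hx hy ⊢
        rw [map_add, inner_add_left, hx, hy, add_zero]
      | smul c x _ hx =>
        simp only [Set.mem_ofPred_eq] at hx ⊢
        rw [map_smul, inner_smul_left, hx, mul_zero]
    exact hc.closure_subset_iff.2 hle (hcl ▸ Set.mem_univ a)
  have h2 : ∀ g : H, inner ℂ g f = 0 := fun g =>
    hJ.induction_on (p := fun g => inner ℂ g f = 0) g
      (isClosed_eq (by fun_prop) continuous_const) h1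
  exact inner_self_eq_zero.1 (h2 f)

section MeasureCauchy

variable (μ : Measure Circle) [IsFiniteMeasure μ]

theorem continuous_diskAlgebraToHardy : Continuous (diskAlgebraToHardy μ) :=
  ((ContinuousMap.toLp 2 μ ℂ : C(Circle, ℂ) →L[ℂ] Lp ℂ 2 μ).continuous.comp
    continuous_subtype_val).subtype_mk _

theorem circleMonomial_mem (n : ℕ) : circleMonomial n ∈ diskAlgebra :=
  ⟨fun w => w ^ n, Differentiable.diffContOnCl (by fun_prop), fun _ => rfl⟩

theorem denseRange_diskAlgebraToHardy : DenseRange (diskAlgebraToHardy μ) := by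
  intro f
  rw [closure_subtype]
  refine closure_mono ?_ f.2
  rintro _ ⟨p, hp, rfl⟩
  have hp' : p ∈ diskAlgebra := by
    refine (Submodule.span_le.2 ?_ : analyticPolynomials ≤ diskAlgebra) hp
    rintro _ ⟨n, rfl⟩
    exact circleMonomial_mem n
  exact ⟨diskAlgebraToHardy μ ⟨p, hp'⟩, ⟨⟨p, hp'⟩, rfl⟩, rfl⟩

/-- The space `ℋ⁺(μ)` of `μ`-Cauchy transforms: its elements are represented by the functions `h`
in `H²(μ)`, with the inner product of `L²(μ)`, and regarded as the functions
`z ↦ ∫ h (ζ) / (1 - z * conj ζ) dμ` on the open unit disk. -/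
def CauchySpace : Type := hardySpace μ

instance : NormedAddCommGroup (CauchySpace μ) := inferInstanceAs (NormedAddCommGroup (hardySpace μ))
instance : InnerProductSpace ℂ (CauchySpace μ) :=
  inferInstanceAs (InnerProductSpace ℂ (hardySpace μ))
instance : CompleteSpace (CauchySpace μ) := inferInstanceAs (CompleteSpace (hardySpace μ))

/-- The Cauchy transform `(C_μ h) (z) = ⟪k_z, h⟫` in `L²(μ)`. -/
def cauchyTransform : CauchySpace μ →L[ℂ] (Complex.UnitDisc → ℂ) :=
  ContinuousLinearMap.pi fun z => (innerSL ℂ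
    (diskAlgebraToHardy μ ⟨szegoKernel z, szegoKernel_mem z⟩) : hardySpace μ →L[ℂ] ℂ)

instance : RKHS ℂ (CauchySpace μ) Complex.UnitDisc ℂ where
  coeCLM := cauchyTransform μ
  coeCLM_injective := by
    refine (injective_iff_map_eq_zero (cauchyTransform μ)).2 fun f hf => ?_
    exact eq_zero_of_inner_szegoKernel ⟨diskAlgebraToHardy μ, continuous_diskAlgebraToHardy μ⟩
      (denseRange_diskAlgebraToHardy μ) f fun z => congrFun hf z

/-- The elements of `ℋ⁺(μ)`, as functions on the disk, are given by the Cauchy integral. -/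
theorem cauchySpace_apply (h : hardySpace μ) (z : Complex.UnitDisc) :
    (show CauchySpace μ from h) z =
      ∫ ζ, (h : Lp ℂ 2 μ) ζ / (1 - (z : ℂ) * conj (ζ : ℂ)) ∂μ := by
  change inner ℂ (ContinuousMap.toLp 2 μ ℂ (szegoKernel z)) (h : Lp ℂ 2 μ) = _
  rw [L2.inner_def]
  refine integral_congr_ae ?_
  filter_upwards [ContinuousMap.coeFn_toLp (p := 2) (𝕜 := ℂ) μ (szegoKernel z)] with ζ hζ
  rw [hζ]
  simp [szegoKernel, div_eq_mul_inv]

end MeasureCauchy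

section FormCauchy

variable (μ : Measure Circle) [IsFiniteMeasure μ] (q : SesqForm diskAlgebra) (hq : q.Nonneg)
  (hle : q.Dominated (measureForm μ))

theorem norm_toCompletion_le (hle : q.Dominated (measureForm μ)) (a : diskAlgebra) :
    ‖q.toCompletion hq a‖ ≤ Real.sqrt (μ.real Set.univ) * ‖a‖ := by
  have h1 : ‖q.toCompletion hq a‖ ^ 2 = (q a a).re := by
    rw [← q.inner_toCompletion hq a a]
    exact (inner_self_eq_norm_sq (𝕜 := ℂ) (q.toCompletion hq a)).symm
  have h2 : (q a a).re ≤ (measureForm μ a a).re := (Complex.le_def.1 (hle a)).1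
  have h3 : (measureForm μ a a).re ≤ ‖a‖ ^ 2 * μ.real Set.univ := by
    refine (Complex.re_le_norm _).trans ?_
    rw [measureForm_apply]
    refine norm_integral_le_of_norm_le_const (.of_forall fun ζ => ?_)
    rw [norm_mul, RCLike.norm_conj, ← sq]
    have := ContinuousMap.norm_coe_le_norm (a : C(Circle, ℂ)) ζ
    gcongr
    exact this
  refine (pow_le_pow_iff_left₀ (norm_nonneg _) (by positivity) two_ne_zero).1 ?_
  rw [mul_pow, Real.sq_sqrt measureReal_nonneg]
  linarith

/-- The canonical map of the disk algebra into the completion for a form below `q_μ`. -/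
def completionMap : diskAlgebra →L[ℂ] q.HilbertCompletion hq :=
  LinearMap.mkContinuous
    { toFun := q.toCompletion hq
      map_add' := fun a b => UniformSpace.Completion.coe_add (α := q.Pre hq) a b
      map_smul' := fun c a => UniformSpace.Completion.coe_smul (X := q.Pre hq) c a }
    (Real.sqrt (μ.real Set.univ)) (norm_toCompletion_le μ q hq hle)

/-- The space `ℋ⁺(q)` of `q`-Cauchy transforms, for a form `0 ≤ q ≤ q_μ` on the disk algebra: its
elements are represented by the vectors `h` in the Hilbert space completion `H²(q)` of the disk
algebra for the pre-inner product `q`, and regarded as the functions `z ↦ q (k_z, h)`. -/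
def FormCauchySpace (_hle : q.Dominated (measureForm μ)) : Type := q.HilbertCompletion hq

instance : NormedAddCommGroup (FormCauchySpace μ q hq hle) :=
  inferInstanceAs (NormedAddCommGroup (q.HilbertCompletion hq))
instance : InnerProductSpace ℂ (FormCauchySpace μ q hq hle) :=
  inferInstanceAs (InnerProductSpace ℂ (q.HilbertCompletion hq))
instance : CompleteSpace (FormCauchySpace μ q hq hle) :=
  inferInstanceAs (CompleteSpace (q.HilbertCompletion hq))

/-- The Cauchy transform `(C_q h) (z) = q (k_z, h)`, where `q` also denotes the inner product of
the completion `H²(q)`. -/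
def formCauchyTransform : FormCauchySpace μ q hq hle →L[ℂ] (Complex.UnitDisc → ℂ) :=
  ContinuousLinearMap.pi fun z => (innerSL ℂ
    (q.toCompletion hq ⟨szegoKernel z, szegoKernel_mem z⟩) : q.HilbertCompletion hq →L[ℂ] ℂ)

instance : RKHS ℂ (FormCauchySpace μ q hq hle) Complex.UnitDisc ℂ where
  coeCLM := formCauchyTransform μ q hq hle
  coeCLM_injective := by
    refine (injective_iff_map_eq_zero (formCauchyTransform μ q hq hle)).2 fun f hf => ?_
    exact eq_zero_of_inner_szegoKernel (completionMap μ q hq hle)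
      (UniformSpace.Completion.denseRange_coe (α := q.Pre hq)) f fun z => congrFun hf z

end FormCauchy

/-! ### Orthogonal sums and intersections of spaces of functions -/

section RKHS

variable {X : Type*}

/-- The vector space of functions underlying a reproducing kernel Hilbert space. -/
def functionsOf (H : Type*) [NormedAddCommGroup H] [InnerProductSpace ℂ H] [RKHS ℂ H X ℂ] :
    Submodule ℂ (X → ℂ) :=
  LinearMap.range (RKHS.coeCLM ℂ : H →L[ℂ] X → ℂ).toLinearMap

/-- `H = K ⊕ L`, an orthogonal direct sum of Hilbert spaces of functions on `X`: the functions of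
`K` and of `L` belong to `H`, with the same inner products, the functions of `K` are orthogonal to
those of `L` in `H`, and every function of `H` is the sum of one of `K` and one of `L`. -/
def IsOrthogonalSum (H K L : Type*)
    [NormedAddCommGroup H] [InnerProductSpace ℂ H] [RKHS ℂ H X ℂ]
    [NormedAddCommGroup K] [InnerProductSpace ℂ K] [RKHS ℂ K X ℂ]
    [NormedAddCommGroup L] [InnerProductSpace ℂ L] [RKHS ℂ L X ℂ] : Prop :=
  ∃ (i : K →ₗᵢ[ℂ] H) (j : L →ₗᵢ[ℂ] H),
    (∀ (f : K) (x : X), i f x = f x) ∧ (∀ (g : L) (x : X), j g x = g x) ∧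
    (∀ (f : K) (g : L), inner ℂ (i f) (j g) = 0) ∧
    ∀ h : H, ∃ (f : K) (g : L), h = i f + j g

end RKHS

/-- The intersection space `int (μ, lam) = ℋ⁺(μ) ∩ ℋ⁺(lam)`. -/
def intersectionSpace (μ lam : Measure Circle) [IsFiniteMeasure μ] [IsFiniteMeasure lam] :
    Submodule ℂ (Complex.UnitDisc → ℂ) :=
  functionsOf (CauchySpace μ) ⊓ functionsOf (CauchySpace lam)

end

/-!
Let `J : A(𝔻) → H²(λ)` and `A : A(𝔻) → H²(μ)` be the canonical maps, and let `N` be the set of all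
`k` with `(0, k)` in the closure of `{(J a, A a)}`. A form dominated by `q_μ` is `⟪C A a, C A b⟫`
for a contraction `C` on `H²(μ)`, and if it is closeable, then `C` vanishes on `N`. Hence the
Simon–Lebesgue parts of `q_μ` are its compressions to `Nᗮ` and to `N`. Their completions are `Nᗮ`
and `N` themselves, which yields the orthogonal sum. A Cauchy transform of `k ∈ H²(μ)` which is also
one of `h ∈ H²(λ)` satisfies `⟪A a, k⟫ = ⟪J a, h⟫`, an equation that extends to the closure of
`{(J a, A a)}`, so that `k` is orthogonal to `N`.
-/

section ClosedRelation

variable {𝕜 V H K K' : Type*} [Ring 𝕜] [AddCommGroup V] [Module 𝕜 V]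
  [AddCommGroup H] [Module 𝕜 H] [TopologicalSpace H] [ContinuousAdd H] [ContinuousConstSMul 𝕜 H]
  [AddCommGroup K] [Module 𝕜 K] [TopologicalSpace K] [ContinuousAdd K] [ContinuousConstSMul 𝕜 K]
  [AddCommGroup K'] [Module 𝕜 K'] [TopologicalSpace K'] [ContinuousAdd K']
  [ContinuousConstSMul 𝕜 K']

/-- The closure of the linear relation `{(J x, A x)}` in `H × K`, that is, of the possibly
multivalued operator `J x ↦ A x`. -/
def closedRelation (J : V →ₗ[𝕜] H) (A : V →ₗ[𝕜] K) : Submodule 𝕜 (H × K) :=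
  (LinearMap.range (J.prod A)).topologicalClosure

/-- The multivalued part `{k | (0, k) ∈ closedRelation J A}` of the closed relation of `J` and `A`.
It vanishes if and only if `J x ↦ A x` is a closable operator. -/
def multivaluedPart (J : V →ₗ[𝕜] H) (A : V →ₗ[𝕜] K) : Submodule 𝕜 K :=
  (closedRelation J A).comap (LinearMap.inr 𝕜 H K)

variable {J : V →ₗ[𝕜] H} {A : V →ₗ[𝕜] K}

theorem isClosed_closedRelation : IsClosed (closedRelation J A : Set (H × K)) :=
  Submodule.isClosed_topologicalClosure _

theorem mem_closedRelation (x : V) : (J x, A x) ∈ closedRelation J A :=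
  Submodule.le_topologicalClosure _ ⟨x, rfl⟩

theorem closedRelation_subset {s : Set (H × K)} (hs : IsClosed s) (h : ∀ x, (J x, A x) ∈ s) :
    (closedRelation J A : Set (H × K)) ⊆ s :=
  closure_minimal (Set.range_subset_iff.2 h) hs

theorem mem_multivaluedPart {k : K} : k ∈ multivaluedPart J A ↔ (0, k) ∈ closedRelation J A :=
  Iff.rfl

theorem isClosed_multivaluedPart : IsClosed (multivaluedPart J A : Set K) :=
  isClosed_closedRelation.preimage (f := fun k : K => ((0 : H), k)) (.prodMk_right 0)

theorem map_mem_multivaluedPart (C : K →L[𝕜] K') {k : K} (hk : k ∈ multivaluedPart J A) :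
    C k ∈ multivaluedPart J (C.toLinearMap ∘ₗ A) := by
  have hcont : Continuous fun p : H × K => (p.1, C p.2) :=
    continuous_fst.prodMk (C.continuous.comp continuous_snd)
  exact closedRelation_subset (isClosed_closedRelation.preimage hcont)
    (mem_closedRelation (A := C.toLinearMap ∘ₗ A)) (mem_multivaluedPart.1 hk)

end ClosedRelation

section NormSq

variable {E F : Type*} [SeminormedAddCommGroup E] [SeminormedAddCommGroup F]

theorem tendsto_norm_sq_add_norm_sq_zero_iff {ι : Type*} {l : Filter ι} {u : ι → E} {v : ι → F} :
    Tendsto (fun i => ‖u i‖ ^ 2 + ‖v i‖ ^ 2) l (𝓝 0) ↔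
      Tendsto (fun i => ‖u i‖) l (𝓝 0) ∧ Tendsto (fun i => ‖v i‖) l (𝓝 0) := by
  refine ⟨fun h => ⟨?_, ?_⟩, fun h => by simpa using (h.1.pow 2).add (h.2.pow 2)⟩
  all_goals
    refine squeeze_zero (fun i => norm_nonneg _) (fun i => Real.le_sqrt_of_sq_le ?_)
      (by simpa using h.sqrt)
  · exact le_add_of_nonneg_right (sq_nonneg _)
  · exact le_add_of_nonneg_left (sq_nonneg _)

theorem tendsto_norm_sq_sub_add_norm_sq_sub_iff {ι : Type*} {l : Filter ι} {u : ι → E} {v : ι → F}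
    {x : E} {y : F} :
    Tendsto (fun i => ‖u i - x‖ ^ 2 + ‖v i - y‖ ^ 2) l (𝓝 0) ↔
      Tendsto u l (𝓝 x) ∧ Tendsto v l (𝓝 y) := by
  rw [tendsto_norm_sq_add_norm_sq_zero_iff, ← tendsto_iff_norm_sub_tendsto_zero,
    ← tendsto_iff_norm_sub_tendsto_zero]

theorem cauchySeq_and_cauchySeq_iff_norm_sq {u : ℕ → E} {v : ℕ → F} :
    Tendsto (fun p : ℕ × ℕ => ‖u p.1 - u p.2‖ ^ 2 + ‖v p.1 - v p.2‖ ^ 2) atTop (𝓝 0) ↔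
      CauchySeq u ∧ CauchySeq v := by
  simp only [tendsto_norm_sq_add_norm_sq_zero_iff, cauchySeq_iff_tendsto_dist_atTop_0,
    dist_eq_norm]

end NormSq

theorem exists_tendsto_of_isClosed_linearPMap {R E F : Type*} [CommRing R]
    [AddCommGroup E] [Module R E] [UniformSpace E] [CompleteSpace E]
    [AddCommGroup F] [Module R F] [UniformSpace F] [CompleteSpace F] {f : E →ₗ.[R] F}
    (hf : f.IsClosed) {u : ℕ → f.domain} (hu : CauchySeq u) (hfu : CauchySeq fun n => f (u n)) :
    ∃ x, Tendsto u atTop (𝓝 x) ∧ Tendsto (fun n => f (u n)) atTop (𝓝 (f x)) := by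
  obtain ⟨x, hx⟩ :=
    cauchySeq_tendsto_of_complete (uniformContinuous_subtype_val.comp_cauchySeq hu)
  obtain ⟨y, hy⟩ := cauchySeq_tendsto_of_complete hfu
  have hxy : (x, y) ∈ f.graph :=
    hf.mem_of_tendsto (hx.prodMk_nhds hy) (.of_forall fun n => f.mem_graph (u n))
  obtain ⟨x, rfl, rfl⟩ := f.mem_graph_iff.1 hxy
  exact ⟨x, tendsto_subtype_rng.2 hx, hy⟩

theorem exists_contraction_of_norm_le {𝕜 V K L : Type*} [RCLike 𝕜] [AddCommGroup V] [Module 𝕜 V]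
    [NormedAddCommGroup K] [InnerProductSpace 𝕜 K] [CompleteSpace K]
    [NormedAddCommGroup L] [NormedSpace 𝕜 L] [CompleteSpace L] {A : V →ₗ[𝕜] K} {T : V →ₗ[𝕜] L}
    (h : ∀ x, ‖T x‖ ≤ ‖A x‖) :
    ∃ C : K →L[𝕜] L, (∀ k, ‖C k‖ ≤ ‖k‖) ∧ ∀ x, C (A x) = T x := by
  let R : Submodule 𝕜 K := (LinearMap.range A).topologicalClosure
  have : CompleteSpace R := (Submodule.isClosed_topologicalClosure _).completeSpace_coe
  let B : V →ₗ[𝕜] R :=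
    A.codRestrict R fun x => Submodule.le_topologicalClosure _ (LinearMap.mem_range_self A x)
  have hB : DenseRange B := fun k => by
    rw [closure_subtype, ← Set.range_comp]
    exact k.2
  have hTB (x : V) : ‖T x‖ ≤ 1 * ‖B x‖ := (h x).trans_eq (one_mul _).symm
  refine ⟨(T.extendOfNorm B).comp R.orthogonalProjectionOnto, fun k => ?_, fun x => ?_⟩
  · calc ‖T.extendOfNorm B (R.orthogonalProjectionOnto k)‖
        ≤ 1 * ‖R.orthogonalProjectionOnto k‖ :=
          LinearMap.norm_extendOfNorm_apply_le hB 1 hTB _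
      _ ≤ ‖k‖ := by rw [one_mul]; exact R.norm_orthogonalProjectionOnto_apply_le k
  · have hproj : R.orthogonalProjectionOnto (A x) = B x :=
      R.orthogonalProjectionOnto_mem_subspace_eq_self (B x)
    rw [ContinuousLinearMap.comp_apply, hproj]
    exact LinearMap.extendOfNorm_eq hB ⟨1, hTB⟩ x

namespace SesqForm

section Completion

variable {V : Type*} [AddCommGroup V] [Module ℂ V]

theorem ext_diag {p q : SesqForm V} (h : ∀ x, p x x = q x x) : p = q := by
  ext x y
  have h_add := h (x + y)
  have h_I := h (x + Complex.I • y)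
  simp only [map_add, LinearMap.add_apply, LinearMap.map_smulₛₗ, LinearMap.smul_apply,
    smul_eq_mul, Complex.conj_I, RingHom.id_apply, h] at h_add h_I
  linear_combination (1 / 2) * h_add - (Complex.I / 2) * h_I +
    (1 / 2) * (p x y - p y x - q x y + q y x) * Complex.I_sq

theorem Dominated.antisymm {p q : SesqForm V} (hpq : p.Dominated q) (hqp : q.Dominated p) :
    p = q :=
  ext_diag fun x => le_antisymm (hpq x) (hqp x)

/-- `SesqForm.toCompletion` as a linear map. -/
noncomputable def toCompletionₗ (q : SesqForm V) (hq : q.Nonneg) :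
    V →ₗ[ℂ] q.HilbertCompletion hq where
  toFun := q.toCompletion hq
  map_add' x y := UniformSpace.Completion.coe_add (α := q.Pre hq) x y
  map_smul' c x := UniformSpace.Completion.coe_smul (X := q.Pre hq) c x

theorem denseRange_toCompletionₗ (q : SesqForm V) (hq : q.Nonneg) :
    DenseRange (q.toCompletionₗ hq) :=
  UniformSpace.Completion.denseRange_coe (α := q.Pre hq)

theorem norm_sq_toCompletionₗ (q : SesqForm V) (hq : q.Nonneg) (x : V) :
    ‖q.toCompletionₗ hq x‖ ^ 2 = (q x x).re := by
  rw [← q.inner_toCompletion hq]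
  exact (inner_self_eq_norm_sq (𝕜 := ℂ) _).symm

end Completion

section Pullback

variable {V K L : Type*} [AddCommGroup V] [Module ℂ V]
  [NormedAddCommGroup K] [InnerProductSpace ℂ K] [NormedAddCommGroup L] [InnerProductSpace ℂ L]

/-- The pullback `(x, y) ↦ ⟪T x, T y⟫` of the inner product along a linear map `T`. -/
noncomputable def pullback (T : V →ₗ[ℂ] K) : SesqForm V :=
  ((innerₛₗ ℂ).comp T).compl₂ T

theorem pullback_self (T : V →ₗ[ℂ] K) (x : V) : pullback T x x = ((‖T x‖ ^ 2 : ℝ) : ℂ) :=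
  (inner_self_eq_norm_sq_to_K _).trans (by push_cast; rfl)

theorem pullback_self_re (T : V →ₗ[ℂ] K) (x : V) : (pullback T x x).re = ‖T x‖ ^ 2 := by
  rw [pullback_self, Complex.ofReal_re]

theorem pullback_nonneg (T : V →ₗ[ℂ] K) : (pullback T).Nonneg := fun x => by
  rw [pullback_self, Complex.zero_le_real]
  positivity

theorem pullback_dominated_pullback_iff {T : V →ₗ[ℂ] K} {S : V →ₗ[ℂ] L} :
    (pullback T).Dominated (pullback S) ↔ ∀ x, ‖T x‖ ≤ ‖S x‖ :=
  forall_congr' fun x => by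
    rw [pullback_self, pullback_self, Complex.real_le_real,
      pow_le_pow_iff_left₀ (norm_nonneg _) (norm_nonneg _) two_ne_zero]

/-- The Hilbert space completion for the form `⟪T x, T y⟫` is the codomain of `T`, if `T` has dense
range. -/
noncomputable def completionEquiv [CompleteSpace K] (T : V →ₗ[ℂ] K) (hT : DenseRange T) :
    (pullback T).HilbertCompletion (pullback_nonneg T) ≃ₗᵢ[ℂ] K :=
  (LinearEquiv.refl ℂ V).extendOfIsometry ((pullback T).toCompletionₗ (pullback_nonneg T)) T
    (denseRange_toCompletionₗ _ _) hT fun x => by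
      rw [← pow_left_inj₀ (norm_nonneg _) (norm_nonneg _) two_ne_zero, norm_sq_toCompletionₗ,
        pullback_self_re, LinearEquiv.refl_apply]

theorem completionEquiv_toCompletion [CompleteSpace K] (T : V →ₗ[ℂ] K) (hT : DenseRange T)
    (x : V) : completionEquiv T hT ((pullback T).toCompletion (pullback_nonneg T) x) = T x :=
  LinearEquiv.extendOfIsometry_eq ..

end Pullback

end SesqForm

namespace ClosedForm

variable {H K : Type*} [NormedAddCommGroup H] [InnerProductSpace ℂ H]
  [NormedAddCommGroup K] [InnerProductSpace ℂ K]

/-- The canonical map of the domain of a closed form into the completion for the form, as an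
unbounded operator on `H`. -/
noncomputable abbrev operator (t : ClosedForm H) :
    H →ₗ.[ℂ] t.form.HilbertCompletion t.nonneg :=
  ⟨t.domain, t.form.toCompletionₗ t.nonneg⟩

theorem norm_sq_operator_sub (t : ClosedForm H) (x y : t.domain) :
    ‖t.operator x - t.operator y‖ ^ 2 = (t.form (x - y) (x - y)).re := by
  rw [← t.form.norm_sq_toCompletionₗ t.nonneg, map_sub]
  rfl

theorem isClosed_operator (t : ClosedForm H) : t.operator.IsClosed := by
  refine IsSeqClosed.isClosed fun w p hw hlim => ?_
  choose u hu using fun n => t.operator.mem_graph_iff'.1 (hw n)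
  obtain rfl : (fun n => ((u n : H), t.operator (u n))) = w := funext hu
  obtain ⟨hfst, hsnd⟩ := (Prod.tendsto_iff _ _).1 hlim
  have hcauchy := cauchySeq_and_cauchySeq_iff_norm_sq.2 ⟨hfst.cauchySeq, hsnd.cauchySeq⟩
  simp only [t.norm_sq_operator_sub] at hcauchy
  obtain ⟨x, hx⟩ := t.complete u hcauchy
  simp only [← t.norm_sq_operator_sub] at hx
  obtain ⟨hux, hvx⟩ := tendsto_norm_sq_sub_add_norm_sq_sub_iff
    (u := fun n => (u n : H)) (x := (x : H)).1 hx
  exact t.operator.mem_graph_iff.2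
    ⟨x, tendsto_nhds_unique hux hfst, tendsto_nhds_unique hvx hsnd⟩

/-- The closed form `⟪f x, f y⟫` of a densely defined closed operator `f`. -/
noncomputable def ofLinearPMap [CompleteSpace H] [CompleteSpace K] (f : H →ₗ.[ℂ] K)
    (hf : f.IsClosed) (hd : Dense (f.domain : Set H)) : ClosedForm H where
  domain := f.domain
  dense_domain := hd
  form := SesqForm.pullback f.toFun
  nonneg := SesqForm.pullback_nonneg _
  complete u hu := by
    have hform (x y : f.domain) :
        (SesqForm.pullback f.toFun (x - y) (x - y)).re = ‖f x - f y‖ ^ 2 := by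
      rw [SesqForm.pullback_self_re, ← LinearPMap.map_sub]
      rfl
    simp only [hform] at hu ⊢
    obtain ⟨hu, hfu⟩ : CauchySeq u ∧ CauchySeq fun n => f (u n) :=
      cauchySeq_and_cauchySeq_iff_norm_sq.1 hu
    obtain ⟨x, hx⟩ := exists_tendsto_of_isClosed_linearPMap hf hu hfu
    exact ⟨x, tendsto_norm_sq_sub_add_norm_sq_sub_iff.2 hx⟩

theorem multivaluedPart_operator_eq_bot {V : Type*} [AddCommGroup V] [Module ℂ V]
    (t : ClosedForm H) {J : V →ₗ[ℂ] H} (hJ : ∀ x, J x ∈ t.domain) :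
    multivaluedPart J (t.form.toCompletionₗ t.nonneg ∘ₗ J.codRestrict t.domain hJ) = ⊥ := by
  refine eq_bot_iff.2 fun k hk => ?_
  have hgraph : (0, k) ∈ t.operator.graph :=
    closedRelation_subset t.isClosed_operator (fun x => t.operator.mem_graph ⟨J x, hJ x⟩) hk
  exact t.operator.graph_fst_eq_zero_snd hgraph rfl

end ClosedForm

namespace SesqForm

section Projection

variable {V K : Type*} [AddCommGroup V] [Module ℂ V] [NormedAddCommGroup K]
  [InnerProductSpace ℂ K]

/-- The component `x ↦ P (A x)` of a linear map `A`, for the orthogonal projection `P` onto a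
subspace `N`. -/
noncomputable def componentIn (N : Submodule ℂ K) [N.HasOrthogonalProjection] (A : V →ₗ[ℂ] K) :
    V →ₗ[ℂ] N :=
  N.orthogonalProjectionOnto.toLinearMap ∘ₗ A

variable (N : Submodule ℂ K) [N.HasOrthogonalProjection] {A : V →ₗ[ℂ] K}

theorem coe_componentIn_add_coe_componentIn_orthogonal (A : V →ₗ[ℂ] K) (x : V) :
    (componentIn N A x : K) + componentIn Nᗮ A x = A x :=
  N.starProjection_add_starProjection_orthogonal (A x)

theorem denseRange_componentIn (hA : DenseRange A) : DenseRange (componentIn N A) := by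
  have hsurj : Function.Surjective N.orthogonalProjectionOnto := fun k =>
    ⟨k, N.orthogonalProjectionOnto_mem_subspace_eq_self k⟩
  exact hsurj.denseRange.comp hA N.orthogonalProjectionOnto.continuous

theorem componentIn_orthogonal_eq_zero {x : V} (hx : A x ∈ N) : componentIn Nᗮ A x = 0 := by
  change Nᗮ.orthogonalProjectionOnto (A x) = 0
  exact N.orthogonalProjectionOnto_orthogonal_apply_eq_zero hx

theorem norm_componentIn_le (A : V →ₗ[ℂ] K) (x : V) : ‖componentIn N A x‖ ≤ ‖A x‖ :=
  N.norm_orthogonalProjectionOnto_apply_le (A x)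

/-- The form `⟪P (A x), P (A y)⟫`, for the orthogonal projection `P` onto a subspace `N`. -/
noncomputable def componentForm (A : V →ₗ[ℂ] K) : SesqForm V := pullback (componentIn N A)

theorem componentForm_nonneg (A : V →ₗ[ℂ] K) : (componentForm N A).Nonneg :=
  pullback_nonneg _

theorem componentForm_dominated (A : V →ₗ[ℂ] K) :
    (componentForm N A).Dominated (pullback A) :=
  pullback_dominated_pullback_iff.2 (norm_componentIn_le N A)

theorem pullback_eq_add_componentForm (A : V →ₗ[ℂ] K) :
    pullback A = componentForm Nᗮ A + componentForm N A :=
  ext_diag fun x => by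
    simp only [LinearMap.add_apply, componentForm, pullback_self]
    rw [← Complex.ofReal_add, N.norm_sq_eq_add_norm_sq_projection, add_comm]
    rfl

/-- The isometric embedding of the completion for the form `⟪P (A x), P (A y)⟫`, where `P` is the
orthogonal projection onto `N`, as the subspace `N`. -/
noncomputable def completionEmbedding [CompleteSpace N] (hA : DenseRange A) :
    (componentForm N A).HilbertCompletion (componentForm_nonneg N A) →ₗᵢ[ℂ] K :=
  N.subtypeₗᵢ.comp (completionEquiv _ (denseRange_componentIn N hA)).toLinearIsometry

theorem completionEmbedding_mem [CompleteSpace N] (hA : DenseRange A)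
    (f : (componentForm N A).HilbertCompletion (componentForm_nonneg N A)) :
    completionEmbedding N hA f ∈ N :=
  Subtype.property _

theorem exists_completionEmbedding_eq [CompleteSpace N] (hA : DenseRange A) (k : N) :
    ∃ f, completionEmbedding N hA f = k :=
  ⟨(completionEquiv _ (denseRange_componentIn N hA)).symm k,
    congrArg Subtype.val (LinearIsometryEquiv.apply_symm_apply _ k)⟩

theorem inner_completionEmbedding [CompleteSpace N] (hA : DenseRange A) (x : V)
    (f : (componentForm N A).HilbertCompletion (componentForm_nonneg N A)) :
    inner ℂ (A x) (completionEmbedding N hA f) =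
      inner ℂ ((componentForm N A).toCompletion (componentForm_nonneg N A) x) f := by
  let e := completionEquiv _ (denseRange_componentIn N hA)
  calc inner ℂ (A x) (e f : K)
      = inner ℂ (componentIn N A x) (e f) :=
        (N.inner_orthogonalProjectionOnto_eq_of_mem_right (e f) (A x)).symm
    _ = inner ℂ (e ((pullback (componentIn N A)).toCompletion (pullback_nonneg _) x)) (e f) := by
        rw [completionEquiv_toCompletion]
    _ = inner ℂ ((componentForm N A).toCompletion (componentForm_nonneg N A) x) f :=
        e.inner_map_map _ _

theorem inner_completionEmbedding_orthogonal [CompleteSpace K] [CompleteSpace N]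
    (hA : DenseRange A)
    (f : (componentForm Nᗮ A).HilbertCompletion (componentForm_nonneg Nᗮ A))
    (g : (componentForm N A).HilbertCompletion (componentForm_nonneg N A)) :
    inner ℂ (completionEmbedding Nᗮ hA f) (completionEmbedding N hA g) = 0 :=
  Submodule.inner_left_of_mem_orthogonal (completionEmbedding_mem N hA g)
    (completionEmbedding_mem Nᗮ hA f)

theorem exists_eq_completionEmbedding_add [CompleteSpace K] [CompleteSpace N]
    (hA : DenseRange A) (k : K) :
    ∃ f g, k = completionEmbedding Nᗮ hA f + completionEmbedding N hA g := by
  obtain ⟨f, hf⟩ := exists_completionEmbedding_eq Nᗮ hA (Nᗮ.orthogonalProjectionOnto k)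
  obtain ⟨g, hg⟩ := exists_completionEmbedding_eq N hA (N.orthogonalProjectionOnto k)
  refine ⟨f, g, ?_⟩
  rw [hf, hg, add_comm]
  exact (N.starProjection_add_starProjection_orthogonal k).symm

end Projection

section SimonLebesgue

variable {V H K : Type*} [AddCommGroup V] [Module ℂ V]
  [NormedAddCommGroup H] [InnerProductSpace ℂ H] [NormedAddCommGroup K] [InnerProductSpace ℂ K]
  {J : V →ₗ[ℂ] H} {A : V →ₗ[ℂ] K}

theorem closeable_pullback [CompleteSpace H] [CompleteSpace K] (hJ : DenseRange J)
    (hA : multivaluedPart J A = ⊥) : (pullback A).Closeable J := by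
  have hfun : ∀ p ∈ closedRelation J A, p.1 = 0 → p.2 = 0 := by
    rintro ⟨_, k⟩ hk rfl
    exact (Submodule.mem_bot ℂ).1 (hA ▸ mem_multivaluedPart.2 hk)
  set f := (closedRelation J A).toLinearPMap
  have hgraph : f.graph = closedRelation J A := Submodule.toLinearPMap_graph_eq _ hfun
  have hmem (x : V) : (J x, A x) ∈ f.graph := hgraph ▸ mem_closedRelation x
  have hdom (x : V) : J x ∈ f.domain := f.mem_domain_of_mem_graph (hmem x)
  have hf : f.IsClosed := by
    rw [LinearPMap.IsClosed, hgraph]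
    exact isClosed_closedRelation
  refine ⟨.ofLinearPMap f hf (hJ.mono (Set.range_subset_iff.2 hdom)), hdom, fun x y => ?_⟩
  change inner ℂ (f ⟨J x, hdom x⟩) (f ⟨J y, hdom y⟩) = inner ℂ (A x) (A y)
  rw [← (f.image_iff (hdom x)).2 (hmem x), ← (f.image_iff (hdom y)).2 (hmem y)]

theorem Closeable.exists_pullback_eq {p : SesqForm V} (hc : p.Closeable J) :
    ∃ (t : ClosedForm H) (T : V →ₗ[ℂ] t.form.HilbertCompletion t.nonneg),
      p = pullback T ∧ multivaluedPart J T = ⊥ := by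
  obtain ⟨t, hJ, ht⟩ := hc
  refine ⟨t, _, ext_diag fun x => ?_, t.multivaluedPart_operator_eq_bot hJ⟩
  exact (ht x x).symm.trans (t.form.inner_toCompletion t.nonneg _ _).symm

variable [CompleteSpace K]

instance : CompleteSpace (multivaluedPart J A) := isClosed_multivaluedPart.completeSpace_coe

theorem Closeable.dominated_componentForm {p : SesqForm V} (hc : p.Closeable J)
    (hp : p.Dominated (pullback A)) :
    p.Dominated (componentForm (multivaluedPart J A)ᗮ A) := by
  obtain ⟨t, T, rfl, hT⟩ := hc.exists_pullback_eq
  obtain ⟨C, hC, hCA⟩ := exists_contraction_of_norm_le (pullback_dominated_pullback_iff.1 hp)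
  have hCN {k : K} (hk : k ∈ multivaluedPart J A) : C k = 0 := by
    have hCk := map_mem_multivaluedPart C hk
    rwa [show C.toLinearMap ∘ₗ A = T from LinearMap.ext hCA, hT, Submodule.mem_bot] at hCk
  refine pullback_dominated_pullback_iff.2 fun x => ?_
  set N := multivaluedPart J A
  calc ‖T x‖ = ‖C (componentIn N A x + componentIn Nᗮ A x)‖ := by
        rw [coe_componentIn_add_coe_componentIn_orthogonal, hCA]
    _ = ‖C (componentIn Nᗮ A x)‖ := by
        rw [map_add, hCN (componentIn N A x).2, zero_add]
    _ ≤ ‖componentIn Nᗮ A x‖ := hC _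

theorem multivaluedPart_componentIn_self :
    multivaluedPart J (componentIn (multivaluedPart J A) A) = ⊤ := by
  refine eq_top_iff.2 fun k _ => ?_
  have hk := map_mem_multivaluedPart (multivaluedPart J A).orthogonalProjectionOnto k.2
  rwa [Submodule.orthogonalProjectionOnto_mem_subspace_eq_self] at hk

theorem multivaluedPart_componentIn_orthogonal :
    multivaluedPart J (componentIn (multivaluedPart J A)ᗮ A) = ⊥ := by
  set N := multivaluedPart J A
  have hsub (x : V) : (J x, (componentIn Nᗮ A x : K)) ∈ closedRelation J A := by
    have h := Submodule.sub_mem _ (mem_closedRelation (J := J) x)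
      (mem_multivaluedPart.1 (componentIn N A x).2)
    rwa [Prod.mk_sub_mk, sub_zero, ← coe_componentIn_add_coe_componentIn_orthogonal N A,
      add_sub_cancel_left] at h
  have hcont : Continuous fun p : H × Nᗮ => (p.1, (p.2 : K)) :=
    continuous_fst.prodMk (continuous_subtype_val.comp continuous_snd)
  refine eq_bot_iff.2 fun k hk => ?_
  have hkN : (k : K) ∈ N := closedRelation_subset (isClosed_closedRelation.preimage hcont) hsub hk
  exact Subtype.ext (inner_self_eq_zero.1 (Submodule.inner_right_of_mem_orthogonal hkN k.2))

theorem Closeable.eq_zero_of_dominated_of_multivaluedPart_eq_top {p : SesqForm V}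
    (hp : p.Nonneg) (hc : p.Closeable J) (hA : multivaluedPart J A = ⊤)
    (hle : p.Dominated (pullback A)) : p = 0 := by
  refine Dominated.antisymm (fun x => ?_) hp
  have hx : componentIn (multivaluedPart J A)ᗮ A x = 0 :=
    componentIn_orthogonal_eq_zero _ (hA ▸ Submodule.mem_top)
  calc p x x ≤ componentForm (multivaluedPart J A)ᗮ A x x := hc.dominated_componentForm hle x
    _ = 0 := by rw [componentForm, pullback_self, hx, norm_zero]; norm_num

theorem isSimonLebesgueDecomposition_pullback [CompleteSpace H] (hJ : DenseRange J)
    (A : V →ₗ[ℂ] K) :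
    IsSimonLebesgueDecomposition J (pullback A)
      (componentForm (multivaluedPart J A)ᗮ A)
      (componentForm (multivaluedPart J A) A) where
  add_eq := pullback_eq_add_componentForm _ A
  nonneg_ac := componentForm_nonneg _ _
  nonneg_s := componentForm_nonneg _ _
  ac_le := componentForm_dominated _ A
  s_le := componentForm_dominated _ A
  closeable_ac := closeable_pullback hJ multivaluedPart_componentIn_orthogonal
  maximal_ac _ _ hc hle := hc.dominated_componentForm hle
  singular_s _ hp hc hle :=
    hc.eq_zero_of_dominated_of_multivaluedPart_eq_top hp multivaluedPart_componentIn_self hle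

end SimonLebesgue

theorem IsSimonLebesgueDecomposition.unique {V H : Type*} [AddCommGroup V] [Module ℂ V]
    [NormedAddCommGroup H] [InnerProductSpace ℂ H] {J : V →ₗ[ℂ] H} {q p₁ s₁ p₂ s₂ : SesqForm V}
    (h₁ : IsSimonLebesgueDecomposition J q p₁ s₁) (h₂ : IsSimonLebesgueDecomposition J q p₂ s₂) :
    p₁ = p₂ ∧ s₁ = s₂ := by
  obtain rfl : p₁ = p₂ := Dominated.antisymm
    (h₂.maximal_ac _ h₁.nonneg_ac h₁.closeable_ac h₁.ac_le)
    (h₁.maximal_ac _ h₂.nonneg_ac h₂.closeable_ac h₂.ac_le)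
  exact ⟨rfl, add_left_cancel (h₁.add_eq.symm.trans h₂.add_eq)⟩

theorem inner_eq_zero_of_mem_multivaluedPart {V H K : Type*} [AddCommGroup V] [Module ℂ V]
    [NormedAddCommGroup H] [InnerProductSpace ℂ H] [NormedAddCommGroup K] [InnerProductSpace ℂ K]
    {J : V →ₗ[ℂ] H} {A : V →ₗ[ℂ] K} {h : H} {k' : K}
    (heq : ∀ x, inner ℂ (A x) k' = inner ℂ (J x) h) {k : K} (hk : k ∈ multivaluedPart J A) :
    inner ℂ k k' = 0 := by
  have hclosed : IsClosed {p : H × K | inner ℂ p.2 k' = inner ℂ p.1 h} :=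
    isClosed_eq (continuous_snd.inner continuous_const) (continuous_fst.inner continuous_const)
  exact (closedRelation_subset hclosed heq hk).trans (inner_zero_left h)

theorem eq_zero_of_inner_toCompletion_eq_inner {V H K : Type*} [AddCommGroup V] [Module ℂ V]
    [NormedAddCommGroup H] [InnerProductSpace ℂ H] [NormedAddCommGroup K] [InnerProductSpace ℂ K]
    [CompleteSpace K] {J : V →ₗ[ℂ] H} {A : V →ₗ[ℂ] K} (hA : DenseRange A) {h : H}
    {f : (componentForm (multivaluedPart J A) A).HilbertCompletion (componentForm_nonneg _ A)}
    (hf : ∀ x, inner ℂ (toCompletion _ (componentForm_nonneg _ A) x) f = inner ℂ (J x) h) :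
    f = 0 := by
  let e := completionEmbedding (multivaluedPart J A) hA
  have he (x : V) : inner ℂ (A x) (e f) = inner ℂ (J x) h :=
    (inner_completionEmbedding _ hA x f).trans (hf x)
  have hef : e f = 0 := inner_self_eq_zero.1 <|
    inner_eq_zero_of_mem_multivaluedPart he (completionEmbedding_mem _ hA f)
  exact e.injective (hef.trans (map_zero e).symm)

end SesqForm

section DiskAlgebra

theorem dense_span_szegoKernel :
    Dense (Submodule.span ℂ (Set.range fun z : Complex.UnitDisc =>
      (⟨szegoKernel z, szegoKernel_mem z⟩ : diskAlgebra)) : Set diskAlgebra) := fun a => by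
  rw [closure_subtype, ← diskAlgebra.coe_subtype, ← Submodule.map_coe, Submodule.map_span,
    ← Set.range_comp]
  exact diskAlgebra_le_closure_szegoKernel a.2

theorem inner_eq_inner_of_szegoKernel {H K : Type*} [NormedAddCommGroup H] [InnerProductSpace ℂ H]
    [NormedAddCommGroup K] [InnerProductSpace ℂ K] (A : diskAlgebra →L[ℂ] K)
    (J : diskAlgebra →L[ℂ] H) {k : K} {h : H}
    (hz : ∀ z, inner ℂ (A ⟨szegoKernel z, szegoKernel_mem z⟩) k =
      inner ℂ (J ⟨szegoKernel z, szegoKernel_mem z⟩) h) (a : diskAlgebra) :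
    inner ℂ (A a) k = inner ℂ (J a) h := by
  have hext : (innerSL ℂ k).comp A = (innerSL ℂ h).comp J := by
    refine ContinuousLinearMap.ext_on dense_span_szegoKernel ?_
    rintro _ ⟨z, rfl⟩
    simpa using congrArg conj (hz z)
  simpa using congrArg conj (DFunLike.congr_fun hext a)

variable (μ : Measure Circle) [IsFiniteMeasure μ]

theorem measureForm_eq_pullback : measureForm μ = SesqForm.pullback (diskAlgebraToHardy μ) := by
  ext a b
  calc measureForm μ a b
      = ∫ ζ, (b : C(Circle, ℂ)) ζ * conj ((a : C(Circle, ℂ)) ζ) ∂μ :=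
        integral_congr_ae (.of_forall fun ζ => mul_comm _ _)
    _ = inner ℂ (diskAlgebraToHardy μ a) (diskAlgebraToHardy μ b) :=
        (ContinuousMap.inner_toLp (𝕜 := ℂ) μ (a : C(Circle, ℂ)) b).symm

theorem isOrthogonalSum_formCauchySpace {p s : SesqForm diskAlgebra} {hp : p.Nonneg}
    {hs : s.Nonneg} {hp_le : p.Dominated (measureForm μ)} {hs_le : s.Dominated (measureForm μ)}
    (N : Submodule ℂ (hardySpace μ)) [CompleteSpace N]
    (hpN : p = SesqForm.componentForm Nᗮ (diskAlgebraToHardy μ))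
    (hsN : s = SesqForm.componentForm N (diskAlgebraToHardy μ)) :
    IsOrthogonalSum (CauchySpace μ) (FormCauchySpace μ p hp hp_le)
      (FormCauchySpace μ s hs hs_le) := by
  subst hpN hsN
  have hA := denseRange_diskAlgebraToHardy μ
  exact ⟨SesqForm.completionEmbedding Nᗮ hA, SesqForm.completionEmbedding N hA,
    fun f _ => SesqForm.inner_completionEmbedding Nᗮ hA _ f,
    fun g _ => SesqForm.inner_completionEmbedding N hA _ g,
    SesqForm.inner_completionEmbedding_orthogonal N hA,
    SesqForm.exists_eq_completionEmbedding_add N hA⟩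

theorem disjoint_functionsOf_formCauchySpace_cauchySpace (lam : Measure Circle)
    [IsFiniteMeasure lam] {q : SesqForm diskAlgebra} (hq : q.Nonneg)
    (hle : q.Dominated (measureForm μ))
    (h_eq_zero : ∀ (f : q.HilbertCompletion hq) (h : hardySpace lam),
      (∀ a, inner ℂ (q.toCompletion hq a) f = inner ℂ (diskAlgebraToHardy lam a) h) → f = 0) :
    Disjoint (functionsOf (FormCauchySpace μ q hq hle)) (functionsOf (CauchySpace lam)) := by
  rw [Submodule.disjoint_def]
  rintro _ ⟨f, rfl⟩ ⟨h, hfh⟩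
  have hinner := inner_eq_inner_of_szegoKernel (completionMap μ q hq hle)
    ⟨diskAlgebraToHardy lam, continuous_diskAlgebraToHardy lam⟩ fun z => (congrFun hfh z).symm
  obtain rfl : f = 0 := h_eq_zero f h hinner
  exact map_zero _

end DiskAlgebra

theorem corollary5p12 (μ lam : Measure Circle) [IsFiniteMeasure μ] [IsFiniteMeasure lam] :
    (∃! d : SesqForm diskAlgebra × SesqForm diskAlgebra,
      SesqForm.IsSimonLebesgueDecomposition (diskAlgebraToHardy lam) (measureForm μ) d.1 d.2) ∧
    ∀ (q_ac q_s : SesqForm diskAlgebra)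
      (hd : SesqForm.IsSimonLebesgueDecomposition (diskAlgebraToHardy lam) (measureForm μ)
        q_ac q_s),
      IsOrthogonalSum (CauchySpace μ)
        (FormCauchySpace μ q_ac hd.nonneg_ac hd.ac_le) (FormCauchySpace μ q_s hd.nonneg_s hd.s_le) ∧
      functionsOf (FormCauchySpace μ q_s hd.nonneg_s hd.s_le) ⊓ intersectionSpace μ lam = ⊥ := by
  have hdec := SesqForm.isSimonLebesgueDecomposition_pullback (denseRange_diskAlgebraToHardy lam)
    (diskAlgebraToHardy μ)
  rw [← measureForm_eq_pullback] at hdec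
  refine ⟨⟨(_, _), hdec, fun d hd => Prod.ext_iff.2 (hd.unique hdec)⟩, fun q_ac q_s hd => ?_⟩
  obtain ⟨h_ac, h_s⟩ := hd.unique hdec
  refine ⟨isOrthogonalSum_formCauchySpace μ _ h_ac h_s, ?_⟩
  subst h_s
  have hdisj := disjoint_functionsOf_formCauchySpace_cauchySpace μ lam hd.nonneg_s hd.s_le
    fun _ _ => SesqForm.eq_zero_of_inner_toCompletion_eq_inner (denseRange_diskAlgebraToHardy μ)
  exact (hdisj.mono_right inf_le_right).eq_bot
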